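/- A source S, a relay R and a destination D communicate in slots, each divided into two subslots. S always has a packet and sends its current packet in the first subslot of every slot; D detects it with probability $p_S^{det}\in[0,1)$. R has an infinite data buffer $Q_d$ and an energy buffer of size $N$. At the beginning of each slot R chooses the data-decoding (DD) mode or the energy-harvesting (EH) mode. In the DD mode it receives the packet of S without error, and stores it in $Q_d$ (and S discards it) exactly if D has not detected it. In the EH mode it harvests a random number $\Gamma\in\{0,\dots,b_{\max}\}$ of energy units; units that exceed the buffer size $N$ are lost. In the second subslot of a slot of either mode, R sends the packet at the head of $Q_d$ exactly if there are at that time at least one packet in $Q_d$ and at least $K$ energy units; this consumes $K$ units, and the packet leaves $Q_d$ exactly if D detects it, which happens with probability $p_R^{det}\in(0,1]$. Detections, harvested amounts and mode choices are independent of one another and over the slots, and the harvested amounts in EH mode are identically distributed with $E(\Gamma)>0$. Assume $b_{\max}\le K$ and $2K\le N$. Under the static time-switching policy with parameter $\alpha\in[0,1]$, R chooses the DD mode with probability $\alpha$ in every slot, whatever the contents of its buffers. The rate of events is the limit, from every initial state, of the expected number of events in the first $n$ slots divided by $n$; the throughput is the rate at which packets are detected at D (from S or from R). $Q_d$ is called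 stable if its arrival rate equals its departure rate, unstable if its arrival rate exceeds its departure rate, and at the boundary of stability under $\alpha$ if it is stable under $\alpha$ and unstable under every static policy with a strictly larger arrival rate. Then every static policy has a throughput. A static policy that maximizes the throughput among the static policies keeps $Q_d$ at the boundary of stability, and conversely a static policy that keeps $Q_d$ at the boundary of stability maximizes the throughput. The throughput-optimal $\alpha$ exists, is unique, and equals $$\alpha^{T}=\frac{E(\Gamma)\,p_R^{det}}{E(\Gamma)\,p_R^{det}+K\,(1-p_S^{det})}.$$ -/

import Mathlib

open Filter Topology

noncomputable section

/-- The data of the three-node network: source S, energy-harvesting relay R, destination D.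
`K` is the number of energy units used for one transmission of R, `N` is the size of the
energy buffer of R, `bmax` is the largest number of energy units that can be harvested in a slot,
`pS` and `pR` are the detection probabilities of the S-D and of the R-D channel, and `γ` is the law
of the number of energy units harvested in a slot spent in the energy-harvesting mode. -/
structure RelayNetwork where
  K : ℕ
  N : ℕ
  bmax : ℕ
  pS : unitInterval
  pR : unitInterval
  γ : PMF (Fin (bmax + 1))

/-- The law of a coin that shows `true` with probability `p`. -/
def coin (p : unitInterval) : PMF Bool :=
  PMF.ofFintype
    (fun b => if b then ENNReal.ofReal (p : ℝ) else ENNReal.ofReal (1 - (p : ℝ)))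
    (by
      have h0 : (0 : ℝ) ≤ p := p.2.1
      have h1 : (0 : ℝ) ≤ 1 - (p : ℝ) := sub_nonneg.mpr p.2.2
      simp [← ENNReal.ofReal_add h0 h1])

namespace RelayNetwork

/-- The mean number of energy units harvested in a slot in the energy-harvesting mode. -/
def meanHarvest (net : RelayNetwork) : ℝ :=
  ∑ m : Fin (net.bmax + 1), (net.γ m).toReal * (m : ℝ)

/-- The state of the relay at the beginning of a slot: number of packets in the (infinite) data
buffer and number of units in the energy buffer, which is at most `N`. -/
structure State (net : RelayNetwork) where
  qd : ℕ
  qe : Fin (net.N + 1)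

/-- The random inputs of one slot. `decode`: the relay is in the data-decoding mode (otherwise it is
in the energy-harvesting mode). `detS`: D detects a packet sent by S in this slot.
`detR`: D detects a packet sent by R in this slot, if R sends one. `harvest`: the number of energy
units that are harvested in this slot, if R is in the energy-harvesting mode. -/
structure Slot (net : RelayNetwork) where
  decode : Bool
  detS : Bool
  detR : Bool
  harvest : Fin (net.bmax + 1)

/-- The law of the inputs of a slot under the static policy that chooses the data-decoding mode with
probability `α`, whatever the state: the four inputs are independent. -/
def slotLaw (net : RelayNetwork) (α : unitInterval) : PMF net.Slot :=
  (coin α).bind fun a => (coin net.pS).bind fun s => (coin net.pR).bind fun r =>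
    net.γ.map fun m => ⟨a, s, r, m⟩

variable {net : RelayNetwork}

/-- Number of packets that enter the data buffer in the first subslot: the packet of S is stored
exactly when R decodes it and D has not detected it. -/
def arrivals (w : net.Slot) : ℕ := if w.decode = true ∧ w.detS = false then 1 else 0

/-- Number of packets in the data buffer at the beginning of the second subslot. -/
def midData (x : net.State) (w : net.Slot) : ℕ := x.qd + arrivals w

/-- Number of energy units in the energy buffer at the beginning of the second subslot; energy
that exceeds the size of the buffer is lost. -/
def midEnergy (x : net.State) (w : net.Slot) : ℕ :=
  if w.decode = true then (x.qe : ℕ) else min ((x.qe : ℕ) + (w.harvest : ℕ)) net.N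

lemma midEnergy_le (x : net.State) (w : net.Slot) : midEnergy x w ≤ net.N := by
  have := x.qe.isLt
  unfold midEnergy
  split_ifs <;> omega

/-- R is active (it transmits in the second subslot): it then has at least one data packet and at
least `K` energy units. -/
def Active (x : net.State) (w : net.Slot) : Prop := 0 < midData x w ∧ net.K ≤ midEnergy x w

open Classical in
/-- Number of packets that leave the data buffer, i.e. that R transmits and D detects. -/
def departures (x : net.State) (w : net.Slot) : ℕ :=
  if Active x w ∧ w.detR = true then 1 else 0

/-- Number of source packets that are detected at D in the slot, from S or from R. -/
def detections (x : net.State) (w : net.Slot) : ℕ :=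
  (if w.detS = true then 1 else 0) + departures x w

open Classical in
/-- The state at the beginning of the next slot. -/
def next (x : net.State) (w : net.Slot) : net.State where
  qd := midData x w - departures x w
  qe := ⟨if Active x w then midEnergy x w - net.K else midEnergy x w, by
    have := midEnergy_le x w
    split_ifs <;> omega⟩

/-- The law of the state at the beginning of slot `n` (from `0`), started in `x₀`, under the
static policy `α`; the inputs of different slots are independent and identically distributed. -/
def stateLaw (α : unitInterval) (x₀ : net.State) : ℕ → PMF net.State
  | 0 => PMF.pure x₀
  | n + 1 => (stateLaw α x₀ n).bind fun x => (net.slotLaw α).map fun w => next x w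

/-- The joint law of the state at the beginning of slot `n` and the inputs of slot `n`. -/
def jointLaw (α : unitInterval) (x₀ : net.State) (n : ℕ) : PMF (net.State × net.Slot) :=
  (stateLaw α x₀ n).bind fun x => (net.slotLaw α).map fun w => (x, w)

/-- The mean in slot `n` of a (bounded) number `f` of events per slot. -/
def meanInSlot (α : unitInterval) (x₀ : net.State) (f : net.State → net.Slot → ℕ) (n : ℕ) : ℝ :=
  ∑' z : net.State × net.Slot, (jointLaw α x₀ n z).toReal * (f z.1 z.2 : ℝ)

/-- Under the static policy `α`, events that occur `f` times per slot have the rate `r`: whatever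
the initial state, the mean number of events in the first `n` slots, divided by `n`, tends
to `r`. -/
def HasRate (α : unitInterval) (f : net.State → net.Slot → ℕ) (r : ℝ) : Prop :=
  ∀ x₀ : net.State,
    Tendsto (fun n : ℕ => (∑ t ∈ Finset.range n, meanInSlot α x₀ f t) / (n : ℝ)) atTop (𝓝 r)

variable (net)

/-- The source throughput under `α` is `r`: the rate at which packets are detected at D. -/
def HasThroughput (α : unitInterval) (r : ℝ) : Prop :=
  HasRate (net := net) α detections r

/-- The arrival rate at the data buffer of R under `α` is `r`. -/
def HasArrivalRate (α : unitInterval) (r : ℝ) : Prop :=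
  HasRate (net := net) α (fun _ w => arrivals w) r

/-- The departure rate from the data buffer of R under `α` is `r`. -/
def HasDepartureRate (α : unitInterval) (r : ℝ) : Prop :=
  HasRate (net := net) α departures r

/-- The data buffer is stable: its arrival rate equals its departure rate. -/
def DataStable (α : unitInterval) : Prop :=
  ∃ r : ℝ, net.HasArrivalRate α r ∧ net.HasDepartureRate α r

/-- The data buffer is unstable: its arrival rate exceeds its departure rate. -/
def DataUnstable (α : unitInterval) : Prop :=
  ∃ a d : ℝ, net.HasArrivalRate α a ∧ net.HasDepartureRate α d ∧ d < a

/-- The static policy `α` keeps the data buffer at the boundary of stability: the buffer is stable,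
and every static policy under which the arrival rate is larger by some `ε > 0` makes it unstable. -/
def AtStabilityBoundary (α : unitInterval) : Prop :=
  net.DataStable α ∧
    ∀ a ε : ℝ, 0 < ε → ∀ β : unitInterval,
      net.HasArrivalRate α a → net.HasArrivalRate β (a + ε) → net.DataUnstable β

/-- The static policy `α` is throughput-optimal: no static policy has a larger throughput. -/
def IsThroughputOptimal (α : unitInterval) : Prop :=
  ∃ r : ℝ, net.HasThroughput α r ∧
    ∀ (β : unitInterval) (r' : ℝ), net.HasThroughput β r' → r' ≤ r

end RelayNetwork

end

/-!
Write `a = α * (1 - pS)` for the arrival rate and `c = pR * (1 - α) * E(Γ) / K` for the rate of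
detected transmissions that the harvested energy can pay for. The departure rate from the data
buffer is `min a c` (`hasDepartureRate_min`). As `a` increases and `c` decreases strictly in `α`, and
the throughput is `pS` plus the departure rate, the throughput has its unique maximum where the two
rates cross, which is also the only point on the boundary of stability.

The departure rate is found without any ergodic theory. The *backlog* `K * Qd + pR * (N - Qe)` is
nonnegative and has bounded increments. In every state its mean increment is `K * (a - c)`, plus `pR`
times the mean amount of energy that is lost by overflow. Since `bmax ≤ K` and `2 * K ≤ N`, energy is
lost only when the data buffer is empty, so that the backlog is at most `N`; the only exception is
the initial state (`not_overcharged_next`).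

* If `a ≤ c`, the square of the backlog has bounded drift, so the mean backlog after `n` slots is
  `O(√n)` (`tendsto_meanAt_backlog_div`). The mean data buffer content is then `o(n)`, and by the
  balance of the data buffer all but `o(n)` arrivals have departed. This includes the critical case
  `a = c`.
* If `c < a`, then `exp (-θ * backlog)` is, for a small `θ`, contracted by the transition operator,
  so the mean total number of slots with an empty data buffer, and with it the mean total amount of
  lost energy, is finite (`exists_sum_overflow_le`). By the balance of the energy buffer nearly all of
  the harvested energy is spent on transmissions.
-/

noncomputable section

namespace PMF

lemma tsum_bind_mul {A B : Type*} (p : PMF A) (f : A → PMF B) (F : B → ENNReal) :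
    ∑' b, p.bind f b * F b = ∑' a, p a * ∑' b, f a b * F b := by
  simp only [PMF.bind_apply, ← ENNReal.tsum_mul_right, ← ENNReal.tsum_mul_left, mul_assoc]
  exact ENNReal.tsum_comm

lemma tsum_pure_mul {A : Type*} (a : A) (F : A → ENNReal) :
    ∑' b, PMF.pure a b * F b = F a := by
  rw [tsum_eq_single a (fun b hb => by simp [PMF.pure_apply, hb])]
  simp

lemma tsum_map_mul {A B : Type*} (p : PMF A) (f : A → B) (F : B → ENNReal) :
    ∑' b, p.map f b * F b = ∑' a, p a * F (f a) := by
  rw [← PMF.bind_pure_comp, tsum_bind_mul]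
  simp only [Function.comp_apply, tsum_pure_mul]

lemma sum_toReal {A : Type*} [Fintype A] (p : PMF A) : ∑ a, (p a).toReal = 1 := by
  rw [← ENNReal.toReal_sum (fun a _ => p.apply_ne_top a), ← tsum_fintype (L := .unconditional A),
    p.tsum_coe, ENNReal.toReal_one]

end PMF

namespace RelayNetwork

/-! ### Means over one slot and over several slots -/

/-- The probability, as a real number, that a coin with success probability `p` shows `b`. -/
def coinWeight (p : unitInterval) (b : Bool) : ℝ := if b then (p : ℝ) else 1 - (p : ℝ)

lemma coinWeight_nonneg (p : unitInterval) (b : Bool) : 0 ≤ coinWeight p b := by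
  have h0 := p.2.1
  have h1 := p.2.2
  cases b <;> simp [coinWeight, h0, h1]

lemma coin_apply (p : unitInterval) (b : Bool) :
    coin p b = ENNReal.ofReal (coinWeight p b) := by
  cases b <;> simp [coin, coinWeight]

variable {net : RelayNetwork}

/-- The mean of `g` over the inputs of one slot, as an explicit finite sum of real numbers. -/
def slotMean (α : unitInterval) (g : net.Slot → ℝ) : ℝ :=
  ∑ a : Bool, ∑ s : Bool, ∑ r : Bool, ∑ m : Fin (net.bmax + 1),
    coinWeight α a * coinWeight net.pS s * coinWeight net.pR r * (net.γ m).toReal * g ⟨a, s, r, m⟩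

lemma weight_nonneg (α : unitInterval) (a s r : Bool) (m : Fin (net.bmax + 1)) :
    0 ≤ coinWeight α a * coinWeight net.pS s * coinWeight net.pR r * (net.γ m).toReal :=
  mul_nonneg (mul_nonneg (mul_nonneg (coinWeight_nonneg _ _) (coinWeight_nonneg _ _))
    (coinWeight_nonneg _ _)) ENNReal.toReal_nonneg

lemma slotMean_add (α : unitInterval) (f g : net.Slot → ℝ) :
    slotMean α (fun w => f w + g w) = slotMean α f + slotMean α g := by
  simp only [slotMean, mul_add, Finset.sum_add_distrib]

lemma slotMean_const_mul (α : unitInterval) (c : ℝ) (f : net.Slot → ℝ) :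
    slotMean α (fun w => c * f w) = c * slotMean α f := by
  simp only [slotMean, Finset.mul_sum]
  refine Finset.sum_congr rfl fun a _ => Finset.sum_congr rfl fun s _ =>
    Finset.sum_congr rfl fun r _ => Finset.sum_congr rfl fun m _ => ?_
  ring

lemma slotMean_sub (α : unitInterval) (f g : net.Slot → ℝ) :
    slotMean α (fun w => f w - g w) = slotMean α f - slotMean α g := by
  simp only [slotMean, mul_sub, Finset.sum_sub_distrib]

lemma slotMean_mono (α : unitInterval) {f g : net.Slot → ℝ} (h : ∀ w, f w ≤ g w) :
    slotMean α f ≤ slotMean α g := by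
  unfold slotMean
  gcongr with a _ s _ r _ m _
  · exact weight_nonneg α a s r m
  · exact h _

lemma slotMean_const (α : unitInterval) (c : ℝ) :
    slotMean α (fun _ : net.Slot => c) = c := by
  simp only [slotMean, ← Finset.sum_mul, ← Finset.mul_sum, PMF.sum_toReal]
  simp [coinWeight]

lemma tsum_slotLaw_mul (α : unitInterval) {g : net.Slot → ℝ} (hg : ∀ w, 0 ≤ g w) :
    ∑' w, net.slotLaw α w * ENNReal.ofReal (g w) = ENNReal.ofReal (slotMean α g) := by
  have hγ : ∀ m, net.γ m = ENNReal.ofReal (net.γ m).toReal := fun m =>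
    (ENNReal.ofReal_toReal (net.γ.apply_ne_top m)).symm
  have hw := weight_nonneg (net := net) α
  unfold slotMean slotLaw
  simp only [PMF.tsum_bind_mul, PMF.tsum_map_mul, tsum_fintype, coin_apply]
  rw [ENNReal.ofReal_sum_of_nonneg fun a _ => Finset.sum_nonneg fun s _ =>
    Finset.sum_nonneg fun r _ => Finset.sum_nonneg fun m _ => mul_nonneg (hw a s r m) (hg _)]
  refine Finset.sum_congr rfl fun a _ => ?_
  rw [ENNReal.ofReal_sum_of_nonneg fun s _ =>
    Finset.sum_nonneg fun r _ => Finset.sum_nonneg fun m _ => mul_nonneg (hw a s r m) (hg _),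
    Finset.mul_sum]
  refine Finset.sum_congr rfl fun s _ => ?_
  rw [ENNReal.ofReal_sum_of_nonneg fun r _ =>
    Finset.sum_nonneg fun m _ => mul_nonneg (hw a s r m) (hg _), Finset.mul_sum, Finset.mul_sum]
  refine Finset.sum_congr rfl fun r _ => ?_
  rw [ENNReal.ofReal_sum_of_nonneg fun m _ => mul_nonneg (hw a s r m) (hg _), Finset.mul_sum,
    Finset.mul_sum, Finset.mul_sum]
  refine Finset.sum_congr rfl fun m _ => ?_
  have ha := coinWeight_nonneg α a
  have hs := coinWeight_nonneg net.pS s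
  have hr := coinWeight_nonneg net.pR r
  rw [ENNReal.ofReal_mul (hw a s r m), ENNReal.ofReal_mul (by positivity),
    ENNReal.ofReal_mul (by positivity), ENNReal.ofReal_mul ha, ← hγ]
  ring

/-- The transition operator of the chain: the mean of `f` at the next state. -/
def stepMean (α : unitInterval) (f : net.State → ℝ) (x : net.State) : ℝ :=
  slotMean α fun w => f (next x w)

/-- The mean of `f` over the state at the beginning of slot `n`, as a function of the initial state.
It is a finite sum for every `f`, so no integrability has to be discussed. -/
def meanAt (α : unitInterval) (n : ℕ) (f : net.State → ℝ) : net.State → ℝ :=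
  (stepMean α)^[n] f

lemma meanAt_succ (α : unitInterval) (n : ℕ) (f : net.State → ℝ) :
    meanAt α (n + 1) f = meanAt α n (stepMean α f) := rfl

lemma meanAt_add (α : unitInterval) (n : ℕ) (f g : net.State → ℝ) (x : net.State) :
    meanAt α n (fun y => f y + g y) x = meanAt α n f x + meanAt α n g x := by
  induction n generalizing f g with
  | zero => rfl
  | succ n ih =>
    simp only [meanAt_succ]
    rw [← ih]
    congr 1
    funext y
    exact slotMean_add α _ _

lemma meanAt_const_mul (α : unitInterval) (n : ℕ) (c : ℝ) (f : net.State → ℝ) (x : net.State) :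
    meanAt α n (fun y => c * f y) x = c * meanAt α n f x := by
  induction n generalizing f with
  | zero => rfl
  | succ n ih =>
    simp only [meanAt_succ]
    rw [← ih]
    congr 1
    funext y
    exact slotMean_const_mul α _ _

lemma meanAt_const (α : unitInterval) (n : ℕ) (c : ℝ) (x : net.State) :
    meanAt α n (fun _ => c) x = c := by
  induction n with
  | zero => rfl
  | succ n ih =>
    rw [meanAt_succ, show stepMean (net := net) α (fun _ => c) = fun _ => c from
      funext fun y => slotMean_const α c, ih]

lemma meanAt_mono (α : unitInterval) (n : ℕ) {f g : net.State → ℝ} (h : ∀ y, f y ≤ g y)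
    (x : net.State) : meanAt α n f x ≤ meanAt α n g x := by
  induction n generalizing f g with
  | zero => exact h x
  | succ n ih => exact ih fun y => slotMean_mono α fun w => h _

lemma meanAt_nonneg (α : unitInterval) (n : ℕ) {f : net.State → ℝ} (h : ∀ y, 0 ≤ f y)
    (x : net.State) : 0 ≤ meanAt α n f x :=
  (meanAt_const α n 0 x).symm.trans_le (meanAt_mono α n h x)

/-- Dynkin's formula: a function with drift `h` changes in the mean by the accumulated drift. -/
lemma meanAt_eq_of_drift (α : unitInterval) {V h : net.State → ℝ}
    (hV : ∀ y, stepMean α V y = V y + h y) (n : ℕ) (x : net.State) :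
    meanAt α n V x = V x + ∑ t ∈ Finset.range n, meanAt α t h x := by
  induction n with
  | zero => simp [meanAt]
  | succ n ih =>
    rw [meanAt_succ, funext hV, meanAt_add, ih, Finset.sum_range_succ, add_assoc]

/-- The Foster-Lyapunov form of Dynkin's formula. -/
lemma meanAt_le_of_drift (α : unitInterval) {V h : net.State → ℝ}
    (hV : ∀ y, stepMean α V y ≤ V y + h y) (n : ℕ) (x : net.State) :
    meanAt α n V x ≤ V x + ∑ t ∈ Finset.range n, meanAt α t h x := by
  induction n with
  | zero => simp [meanAt]
  | succ n ih =>
    have := meanAt_mono α n hV x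
    rw [meanAt_add] at this
    rw [meanAt_succ, Finset.sum_range_succ]
    linarith

lemma tsum_stateLaw_mul (α : unitInterval) (x : net.State) (n : ℕ) {f : net.State → ℝ}
    (hf : ∀ y, 0 ≤ f y) :
    ∑' y, stateLaw α x n y * ENNReal.ofReal (f y) = ENNReal.ofReal (meanAt α n f x) := by
  induction n generalizing f with
  | zero => exact PMF.tsum_pure_mul _ _
  | succ n ih =>
    rw [meanAt_succ, ← ih (f := stepMean α f)
      (fun y => (slotMean_const α 0).symm.trans_le (slotMean_mono α fun w => hf _))]
    simp only [stateLaw, PMF.tsum_bind_mul, PMF.tsum_map_mul]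
    exact tsum_congr fun y => congrArg _ (tsum_slotLaw_mul α fun w => hf _)

/-- The mean number of events in slot `n` is computed by the iterated transition operator. -/
lemma meanInSlot_eq (α : unitInterval) (x : net.State) (f : net.State → net.Slot → ℕ) (n : ℕ) :
    meanInSlot α x f n = meanAt α n (fun y => slotMean α fun w => (f y w : ℝ)) x := by
  have hpos : ∀ y, 0 ≤ slotMean α fun w => (f y w : ℝ) := fun y =>
    (slotMean_const α 0).symm.trans_le (slotMean_mono α fun w => Nat.cast_nonneg _)
  have key : ∑' z, jointLaw α x n z * ENNReal.ofReal (f z.1 z.2 : ℝ) =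
      ENNReal.ofReal (meanAt α n (fun y => slotMean α fun w => (f y w : ℝ)) x) := by
    rw [← tsum_stateLaw_mul α x n hpos]
    simp only [jointLaw, PMF.tsum_bind_mul, PMF.tsum_map_mul]
    exact tsum_congr fun y => congrArg _ (tsum_slotLaw_mul α fun w => Nat.cast_nonneg _)
  rw [← ENNReal.toReal_ofReal (meanAt_nonneg α n hpos x), ← key, ENNReal.tsum_toReal_eq
    fun z => ENNReal.mul_ne_top (PMF.apply_ne_top _ _) ENNReal.ofReal_ne_top]
  exact tsum_congr fun z => by
    rw [ENNReal.toReal_mul, ENNReal.toReal_ofReal (Nat.cast_nonneg _)]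

lemma hasRate_iff (α : unitInterval) (f : net.State → net.Slot → ℕ) (r : ℝ) :
    HasRate α f r ↔ ∀ x, Tendsto (fun n : ℕ => (∑ t ∈ Finset.range n,
      meanAt α t (fun y => slotMean α fun w => (f y w : ℝ)) x) / (n : ℝ)) atTop (𝓝 r) := by
  simp only [HasRate, meanInSlot_eq]

/-! ### The balance equations of the two buffers -/

open Classical in
/-- The number (`0` or `1`) of transmissions of the relay in a slot. -/
def transmissions (x : net.State) (w : net.Slot) : ℝ := if Active x w then 1 else 0

/-- The number of energy units harvested in a slot, including those that are lost. -/
def harvested (w : net.Slot) : ℝ := if w.decode = true then 0 else ((w.harvest : ℕ) : ℝ)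

/-- The number of energy units lost in a slot because the energy buffer is full. -/
def overflow (x : net.State) (w : net.Slot) : ℝ :=
  ((x.qe : ℕ) : ℝ) + harvested w - (midEnergy x w : ℝ)

lemma harvested_nonneg (w : net.Slot) : 0 ≤ harvested w := by
  unfold harvested; split_ifs <;> positivity

lemma harvested_le (hb : net.bmax ≤ net.K) (w : net.Slot) : harvested w ≤ net.K := by
  unfold harvested
  split_ifs
  · positivity
  · exact_mod_cast (Nat.le_of_lt_succ w.harvest.isLt).trans hb

lemma overflow_nonneg (x : net.State) (w : net.Slot) : 0 ≤ overflow x w := by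
  unfold overflow harvested midEnergy
  split_ifs
  · simp
  · rw [sub_nonneg]
    exact_mod_cast min_le_left _ _

lemma overflow_le_harvested (x : net.State) (w : net.Slot) : overflow x w ≤ harvested w := by
  have hx := x.qe.isLt
  have : (x.qe : ℕ) ≤ midEnergy x w := by
    unfold midEnergy
    split_ifs
    · rfl
    · exact le_min (Nat.le_add_right _ _) (by omega)
  have : ((x.qe : ℕ) : ℝ) ≤ midEnergy x w := by exact_mod_cast this
  unfold overflow
  linarith

lemma overflow_eq_zero (hb : net.bmax ≤ net.K) {x : net.State} (h : (x.qe : ℕ) + net.K ≤ net.N)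
    (w : net.Slot) : overflow x w = 0 := by
  have hw := w.harvest.isLt
  unfold overflow harvested midEnergy
  split_ifs
  · simp
  · rw [min_eq_left (by omega)]
    push_cast
    ring

lemma next_qd (x : net.State) (w : net.Slot) :
    ((next x w).qd : ℝ) = x.qd + arrivals w - departures x w := by
  have h : departures x w ≤ midData x w := by
    unfold departures
    split_ifs with h
    · exact h.1.1
    · exact Nat.zero_le _
  change ((midData x w - departures x w : ℕ) : ℝ) = _
  rw [Nat.cast_sub h, midData, Nat.cast_add]

lemma next_qe (x : net.State) (w : net.Slot) :
    (((next x w).qe : ℕ) : ℝ) =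
      (x.qe : ℕ) + harvested w - overflow x w - net.K * transmissions x w := by
  unfold overflow transmissions
  simp only [next]
  split_ifs with h
  · rw [Nat.cast_sub h.2]
    ring
  · ring

lemma slotMean_arrivals (α : unitInterval) :
    slotMean α (fun w : net.Slot => (arrivals w : ℝ)) = α * (1 - net.pS) := by
  simp only [slotMean, Fintype.sum_bool, arrivals, coinWeight, ← Finset.sum_mul, ← Finset.mul_sum,
    PMF.sum_toReal]
  simp
  ring

lemma slotMean_harvested (α : unitInterval) :
    slotMean α (harvested (net := net)) = (1 - α) * net.meanHarvest := by
  simp only [slotMean, Fintype.sum_bool, harvested, coinWeight, mul_assoc, ← Finset.mul_sum,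
    meanHarvest]
  simp only [if_true, Bool.false_eq_true, if_false, mul_zero, Finset.sum_const_zero]
  ring

/-- The detection of a packet of the relay is independent of whether the relay transmits. -/
lemma slotMean_departures (α : unitInterval) (x : net.State) :
    slotMean α (fun w => (departures x w : ℝ)) = net.pR * slotMean α (transmissions x) := by
  have hA : ∀ a s m, Active x ⟨a, s, false, m⟩ = Active x ⟨a, s, true, m⟩ := fun _ _ _ => rfl
  simp only [slotMean, departures, transmissions, Finset.mul_sum]
  refine Finset.sum_congr rfl fun a _ => Finset.sum_congr rfl fun s _ => ?_
  simp only [Fintype.sum_bool, ← Finset.sum_add_distrib]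
  refine Finset.sum_congr rfl fun m _ => ?_
  by_cases h : Active x ⟨a, s, true, m⟩
  · have ht : coinWeight net.pR true = net.pR := rfl
    have hf : coinWeight net.pR false = 1 - net.pR := rfl
    simp only [hA, h, ht, hf, and_self, and_false, if_true, if_false, Bool.false_eq_true,
      Nat.cast_one, Nat.cast_zero]
    ring
  · simp [hA, h]

lemma slotMean_detections (α : unitInterval) (x : net.State) :
    slotMean α (fun w => (detections x w : ℝ)) =
      net.pS + slotMean α (fun w => (departures x w : ℝ)) := by
  have h : slotMean α (fun w : net.Slot => if w.detS = true then (1 : ℝ) else 0) = net.pS := by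
    simp only [slotMean, Fintype.sum_bool, coinWeight, ← Finset.sum_mul, ← Finset.mul_sum,
      PMF.sum_toReal]
    simp
    ring
  rw [← h, ← slotMean_add]
  simp [detections]

/-! ### The backlog and its drift -/

/-- The combined state of the two buffers: the data buffer, weighted by `K`, plus the empty part of
the energy buffer, weighted by `pR`. The weights make the mean change in a slot without overflow the
same in every state. -/
def backlog (x : net.State) : ℝ := net.K * x.qd + net.pR * (net.N - ((x.qe : ℕ) : ℝ))

/-- The change of the backlog in a slot, up to the contribution of lost energy. -/
def increment (x : net.State) (w : net.Slot) : ℝ :=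
  net.K * arrivals w - net.K * departures x w - net.pR * harvested w
    + net.pR * (net.K * transmissions x w)

/-- The mean change of the backlog in a slot without overflow: `K` times the arrival rate minus
`pR` times the rate of harvested energy. -/
def drift (net : RelayNetwork) (α : unitInterval) : ℝ :=
  net.K * (α * (1 - net.pS)) - net.pR * ((1 - α) * net.meanHarvest)

lemma backlog_next (x : net.State) (w : net.Slot) :
    backlog (next x w) = backlog x + increment x w + net.pR * overflow x w := by
  unfold backlog increment
  rw [next_qd, next_qe]
  ring

lemma slotMean_increment (α : unitInterval) (x : net.State) :
    slotMean α (increment x) = drift net α := by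
  unfold increment
  rw [slotMean_add, slotMean_sub, slotMean_sub]
  simp only [slotMean_const_mul]
  rw [slotMean_arrivals, slotMean_harvested, slotMean_departures, drift]
  ring

lemma mul_qd_le_backlog (x : net.State) : net.K * (x.qd : ℝ) ≤ backlog x := by
  have h : ((x.qe : ℕ) : ℝ) ≤ net.N := by exact_mod_cast Nat.le_of_lt_succ x.qe.isLt
  have := mul_nonneg net.pR.2.1 (sub_nonneg.mpr h)
  unfold backlog
  linarith

lemma backlog_nonneg (x : net.State) : 0 ≤ backlog x :=
  (by positivity : 0 ≤ net.K * (x.qd : ℝ)).trans (mul_qd_le_backlog x)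

lemma backlog_le_of_qd_eq_zero {x : net.State} (h : x.qd = 0) : backlog x ≤ net.N := by
  have hp := net.pR.2.2
  have hp0 := net.pR.2.1
  have hN : (0 : ℝ) ≤ net.N := Nat.cast_nonneg _
  have hq : (0 : ℝ) ≤ ((x.qe : ℕ) : ℝ) := Nat.cast_nonneg _
  rw [backlog, h]
  have := mul_nonneg hp0 hq
  have := mul_le_mul_of_nonneg_right hp hN
  push_cast
  linarith

lemma transmissions_nonneg (x : net.State) (w : net.Slot) : 0 ≤ transmissions x w := by
  unfold transmissions
  split_ifs <;> norm_num

lemma transmissions_le_one (x : net.State) (w : net.Slot) : transmissions x w ≤ 1 := by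
  unfold transmissions
  split_ifs <;> norm_num

lemma abs_increment_le (hb : net.bmax ≤ net.K) (x : net.State) (w : net.Slot) :
    |increment x w| ≤ 2 * net.K := by
  have hK : (0 : ℝ) ≤ net.K := Nat.cast_nonneg _
  have ha0 : (0 : ℝ) ≤ net.K * arrivals w := by positivity
  have ha : (net.K : ℝ) * arrivals w ≤ net.K := by
    unfold arrivals
    split_ifs <;> simp
  have hd0 : (0 : ℝ) ≤ net.K * departures x w := by positivity
  have hd : (net.K : ℝ) * departures x w ≤ net.K := by
    unfold departures
    split_ifs <;> simp
  have hh0 := mul_nonneg net.pR.2.1 (harvested_nonneg w)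
  have hh := (mul_le_of_le_one_left (harvested_nonneg w) net.pR.2.2).trans (harvested_le hb w)
  have ht' := mul_nonneg hK (transmissions_nonneg x w)
  have ht0 := mul_nonneg net.pR.2.1 ht'
  have ht := (mul_le_of_le_one_left ht' net.pR.2.2).trans
    (mul_le_of_le_one_right hK (transmissions_le_one x w))
  unfold increment
  rw [abs_le]
  constructor <;> linarith

/-! ### Energy is lost only when the data buffer is empty -/

/-- The states in which a packet is waiting although the energy buffer may overflow in the next
slot. They occur as initial states only. -/
def Overcharged (x : net.State) : Prop := 0 < x.qd ∧ net.N < (x.qe : ℕ) + net.K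

open Classical in
/-- The indicator function of the overcharged states. -/
def overchargedIndicator (x : net.State) : ℝ := if Overcharged x then 1 else 0

lemma overchargedIndicator_nonneg (x : net.State) : 0 ≤ overchargedIndicator x := by
  unfold overchargedIndicator
  split_ifs <;> norm_num

/-- If a packet is left after the slot, then either the relay has transmitted, which frees `K` units
of the energy buffer, or it has less than `K` units. -/
lemma not_overcharged_next (hN : 2 * net.K ≤ net.N) (x : net.State) (w : net.Slot) :
    ¬ Overcharged (next x w) := by
  rintro ⟨h1, h2⟩
  have hle := midEnergy_le x w
  simp only [next] at h1 h2
  split_ifs at h2 with hA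
  · have := hA.2
    omega
  · have : ¬ net.K ≤ midEnergy x w := fun h => hA ⟨by omega, h⟩
    omega

lemma overchargedIndicator_next (hN : 2 * net.K ≤ net.N) (x : net.State) (w : net.Slot) :
    overchargedIndicator (next x w) = 0 := if_neg (not_overcharged_next hN x w)

lemma overflow_le (hb : net.bmax ≤ net.K) (x : net.State) (w : net.Slot) :
    overflow x w ≤ net.K := (overflow_le_harvested x w).trans (harvested_le hb w)

lemma overflow_eq_zero_of_not_overcharged (hb : net.bmax ≤ net.K) {x : net.State}
    (hq : x.qd ≠ 0) (hx : ¬ Overcharged x) (w : net.Slot) : overflow x w = 0 :=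
  overflow_eq_zero hb (not_lt.mp fun h => hx ⟨Nat.pos_of_ne_zero hq, h⟩) w

/-! ### The departure rate when the drift is not positive -/

/-- A pathwise bound for the square of the backlog. The product of backlog and overflow is bounded
except in overcharged states, because the backlog is bounded where the data buffer is empty. -/
lemma backlog_next_sq_le (hb : net.bmax ≤ net.K) (x : net.State) (w : net.Slot) :
    backlog (next x w) ^ 2 ≤ backlog x ^ 2 + 2 * backlog x * increment x w +
      2 * net.K * (backlog x * overchargedIndicator x) +
      (2 * net.K * net.N + 9 * (net.K : ℝ) ^ 2) := by
  have hX := backlog_nonneg x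
  have hK : (0 : ℝ) ≤ net.K := Nat.cast_nonneg _
  have hNn : (0 : ℝ) ≤ net.N := Nat.cast_nonneg _
  have ho0 := mul_nonneg net.pR.2.1 (overflow_nonneg x w)
  have ho := (mul_le_of_le_one_left (overflow_nonneg x w) net.pR.2.2).trans (overflow_le hb x w)
  have hξ := abs_le.mp (abs_increment_le hb x w)
  have hprod : backlog x * (net.pR * overflow x w) ≤
      net.K * (backlog x * overchargedIndicator x) + net.K * net.N := by
    have hB := mul_nonneg hK (mul_nonneg hX (overchargedIndicator_nonneg x))
    have hKN := mul_nonneg hK hNn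
    by_cases hq : x.qd = 0
    · have := mul_le_mul (backlog_le_of_qd_eq_zero hq) ho ho0 hNn
      linarith
    · by_cases hx : Overcharged x
      · have h1 : overchargedIndicator x = 1 := if_pos hx
        have := mul_le_mul_of_nonneg_left ho hX
        rw [h1]
        linarith
      · rw [overflow_eq_zero_of_not_overcharged hb hq hx]
        linarith
  have hsq : (increment x w + net.pR * overflow x w) ^ 2 ≤ (3 * net.K) ^ 2 :=
    sq_le_sq' (by linarith) (by linarith)
  rw [backlog_next]
  nlinarith

lemma stepMean_backlog_sq_le (hb : net.bmax ≤ net.K) (hN : 2 * net.K ≤ net.N) {α : unitInterval}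
    (hα : drift net α ≤ 0) (x : net.State) :
    stepMean α (fun y => backlog y ^ 2 + 2 * net.K * (backlog y * overchargedIndicator y)) x ≤
      (backlog x ^ 2 + 2 * net.K * (backlog x * overchargedIndicator x)) +
      (2 * net.K * net.N + 9 * (net.K : ℝ) ^ 2) := by
  unfold stepMean
  simp only [overchargedIndicator_next hN, mul_zero, add_zero]
  refine (slotMean_mono α fun w => backlog_next_sq_le hb x w).trans ?_
  rw [slotMean_add, slotMean_add, slotMean_add, slotMean_const_mul, slotMean_increment,
    slotMean_const, slotMean_const, slotMean_const]
  have := mul_nonneg_of_nonpos_of_nonpos (neg_nonpos.mpr (backlog_nonneg x)) hα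
  linarith

/-- Without positive drift the mean backlog grows at most like the square root of the time. -/
lemma tendsto_meanAt_backlog_div (hb : net.bmax ≤ net.K) (hN : 2 * net.K ≤ net.N)
    {α : unitInterval} (hα : drift net α ≤ 0) (x : net.State) :
    Tendsto (fun n : ℕ => meanAt α n backlog x / (n : ℝ)) atTop (𝓝 0) := by
  set V : net.State → ℝ :=
    fun y => backlog y ^ 2 + 2 * net.K * (backlog y * overchargedIndicator y) with hV
  set C : ℝ := 2 * net.K * net.N + 9 * (net.K : ℝ) ^ 2 with hC
  have hC0 : 0 ≤ C := by positivity
  have hVsq : ∀ y, backlog y ^ 2 ≤ V y := fun y => by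
    have := mul_nonneg (backlog_nonneg y) (overchargedIndicator_nonneg y)
    have := mul_nonneg (Nat.cast_nonneg (α := ℝ) net.K) this
    simp only [hV]
    linarith
  have hV0 : 0 ≤ V x := (sq_nonneg _).trans (hVsq x)
  have hbound : ∀ n : ℕ, meanAt α n V x ≤ V x + n * C := fun n => by
    have := meanAt_le_of_drift α (stepMean_backlog_sq_le hb hN hα) n x
    simpa only [meanAt_const, Finset.sum_const, Finset.card_range, nsmul_eq_mul] using this
  have hlim : Tendsto (fun n : ℕ => (V x + C + 1) / √(n : ℝ)) atTop (𝓝 0) :=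
    tendsto_const_nhds.div_atTop (Real.tendsto_sqrt_atTop.comp tendsto_natCast_atTop_atTop)
  refine squeeze_zero' (Eventually.of_forall fun n => div_nonneg
    (meanAt_nonneg α n backlog_nonneg x) (Nat.cast_nonneg _)) ?_ hlim
  filter_upwards [eventually_ge_atTop 1] with n hn
  have hn1 : (1 : ℝ) ≤ n := by exact_mod_cast hn
  have hs : √(n : ℝ) * √(n : ℝ) = n := Real.mul_self_sqrt (by linarith)
  have hs1 : 1 ≤ √(n : ℝ) := Real.one_le_sqrt.mpr hn1
  -- Integrate `2 * √n * backlog ≤ backlog ^ 2 + n`.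
  have hamgm : 2 * √(n : ℝ) * meanAt α n backlog x ≤ meanAt α n V x + n := by
    have h := meanAt_mono α n (f := fun y => 2 * √(n : ℝ) * backlog y)
      (g := fun y => V y + (n : ℝ)) (fun y => by
        have := hVsq y
        nlinarith [sq_nonneg (backlog y - √(n : ℝ))]) x
    rwa [meanAt_const_mul, meanAt_add, meanAt_const] at h
  have h1 : √(n : ℝ) * meanAt α n backlog x ≤ (V x + C + 1) * n := by
    have := hbound n
    have := mul_le_mul_of_nonneg_left hn1 hV0
    nlinarith
  rw [div_le_div_iff₀ (by linarith) (by linarith)]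
  linarith

lemma hasDepartureRate_of_drift_nonpos (hb : net.bmax ≤ net.K) (hN : 2 * net.K ≤ net.N)
    (hK : 0 < net.K) {α : unitInterval} (hα : drift net α ≤ 0) :
    net.HasDepartureRate α (α * (1 - net.pS)) := by
  refine (hasRate_iff _ _ _).mpr fun x => ?_
  set D : ℕ → ℝ := fun n => ∑ t ∈ Finset.range n,
    meanAt α t (fun y => slotMean α fun w => (departures y w : ℝ)) x with hD
  have hKr : (0 : ℝ) < net.K := by exact_mod_cast hK
  have hstep : ∀ y : net.State, stepMean α (fun y => (y.qd : ℝ)) y =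
      y.qd + (α * (1 - net.pS) + -1 * slotMean α fun w => (departures y w : ℝ)) := fun y => by
    simp only [stepMean, next_qd]
    rw [slotMean_sub, slotMean_add, slotMean_const, slotMean_arrivals]
    ring
  have hbal : ∀ n : ℕ, meanAt α n (fun y => (y.qd : ℝ)) x =
      x.qd + n * (α * (1 - net.pS)) - D n := fun n => by
    rw [meanAt_eq_of_drift α hstep]
    simp only [meanAt_add, meanAt_const_mul, meanAt_const, Finset.sum_add_distrib,
      Finset.sum_const, Finset.card_range, nsmul_eq_mul, ← Finset.mul_sum, hD]
    ring
  have hqd : Tendsto (fun n : ℕ => meanAt α n (fun y => (y.qd : ℝ)) x / (n : ℝ)) atTop (𝓝 0) := by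
    have hlim := (tendsto_meanAt_backlog_div hb hN hα x).const_mul (net.K : ℝ)⁻¹
    rw [mul_zero] at hlim
    refine squeeze_zero (fun n => div_nonneg (meanAt_nonneg α n (fun y => Nat.cast_nonneg _) x)
      (Nat.cast_nonneg _)) (fun n => ?_) hlim
    rw [← mul_div_assoc, ← meanAt_const_mul]
    refine div_le_div_of_nonneg_right (meanAt_mono α n (fun y => ?_) x) (Nat.cast_nonneg _)
    rw [inv_mul_eq_div, le_div_iff₀ hKr, mul_comm]
    exact mul_qd_le_backlog y
  have hx : Tendsto (fun n : ℕ => (x.qd : ℝ) / (n : ℝ)) atTop (𝓝 0) :=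
    tendsto_const_nhds.div_atTop tendsto_natCast_atTop_atTop
  have hsum := (hx.add_const ((α : ℝ) * (1 - net.pS))).sub hqd
  rw [zero_add, sub_zero] at hsum
  refine hsum.congr' ?_
  filter_upwards [eventually_ge_atTop 1] with n hn
  have hn0 : (n : ℝ) ≠ 0 := by exact_mod_cast Nat.one_le_iff_ne_zero.mp hn
  rw [hbal]
  field_simp
  ring

/-! ### The departure rate when the drift is positive -/

/-- Lost energy only increases the backlog, so it can be ignored in this estimate. -/
lemma stepMean_exp_backlog_le (hb : net.bmax ≤ net.K) (α : unitInterval) {θ : ℝ} (hθ : 0 ≤ θ)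
    (hθK : θ * (2 * net.K) ≤ 1) (x : net.State) :
    stepMean α (fun y => Real.exp (-(θ * backlog y))) x ≤
      Real.exp (-(θ * backlog x)) * (1 - θ * drift net α + (θ * (2 * net.K)) ^ 2) := by
  have hpath : ∀ w, Real.exp (-(θ * backlog (next x w))) ≤ Real.exp (-(θ * backlog x)) *
      ((1 + (θ * (2 * net.K)) ^ 2) - θ * increment x w) := fun w => by
    have ho := mul_nonneg hθ (mul_nonneg net.pR.2.1 (overflow_nonneg x w))
    have hu : |-(θ * increment x w)| ≤ θ * (2 * net.K) := by
      rw [abs_neg, abs_mul, abs_of_nonneg hθ]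
      exact mul_le_mul_of_nonneg_left (abs_increment_le hb x w) hθ
    have he := (abs_le.mp (Real.abs_exp_sub_one_sub_id_le (hu.trans hθK))).2
    have hsq : (-(θ * increment x w)) ^ 2 ≤ (θ * (2 * net.K)) ^ 2 :=
      sq_le_sq' (abs_le.mp hu).1 (abs_le.mp hu).2
    have hle : Real.exp (-(θ * backlog (next x w))) ≤
        Real.exp (-(θ * backlog x)) * Real.exp (-(θ * increment x w)) := by
      rw [← Real.exp_add, backlog_next]
      exact Real.exp_le_exp.mpr (by linarith)
    exact hle.trans (mul_le_mul_of_nonneg_left (by linarith) (Real.exp_nonneg _))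
  refine (slotMean_mono α hpath).trans_eq ?_
  rw [slotMean_const_mul, slotMean_sub, slotMean_const, slotMean_const_mul, slotMean_increment]
  ring

/-- With positive drift the empty data buffer is transient, and the mean of the total amount of lost
energy is finite. -/
lemma exists_sum_overflow_le (hb : net.bmax ≤ net.K) (hN : 2 * net.K ≤ net.N) (hK : 0 < net.K)
    {α : unitInterval} (hα : 0 < drift net α) (x : net.State) :
    ∃ C : ℝ, ∀ n : ℕ,
      ∑ t ∈ Finset.range n, meanAt α t (fun y => slotMean α (overflow y)) x ≤ C := by
  have hKr : (0 : ℝ) < net.K := by exact_mod_cast hK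
  set μ := drift net α with hμ
  have hμK : μ ≤ 2 * net.K := by
    rw [hμ, ← slotMean_increment α x, ← slotMean_const (net := net) α (2 * (net.K : ℝ))]
    exact slotMean_mono α fun w => (abs_le.mp (abs_increment_le hb x w)).2
  -- The value of `θ` that minimizes the factor `1 - θ * μ + (θ * (2 * K)) ^ 2`.
  set θ : ℝ := μ / (8 * (net.K : ℝ) ^ 2) with hθ
  have hθ0 : 0 < θ := by positivity
  have hθμ : θ * (8 * (net.K : ℝ) ^ 2) = μ := div_mul_cancel₀ _ (by positivity)
  have hθK : θ * (2 * net.K) ≤ 1 := by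
    have : θ * (2 * net.K) * (4 * net.K) ≤ 1 * (4 * net.K) := by
      calc θ * (2 * net.K) * (4 * net.K) = μ := by rw [← hθμ]; ring
        _ ≤ 1 * (4 * net.K) := by linarith
    exact le_of_mul_le_mul_right this (by positivity)
  set δ : ℝ := θ * μ / 2 with hδ
  have hδ0 : 0 < δ := by positivity
  set A : ℝ := net.K * Real.exp (θ * net.N) / δ with hA
  have hA0 : 0 ≤ A := by positivity
  set U : net.State → ℝ :=
    fun y => A * Real.exp (-(θ * backlog y)) + net.K * overchargedIndicator y with hU
  have hU0 : ∀ y, 0 ≤ U y := fun y =>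
    add_nonneg (mul_nonneg hA0 (Real.exp_nonneg _))
      (mul_nonneg hKr.le (overchargedIndicator_nonneg y))
  have hover : ∀ y : net.State, slotMean α (overflow y) ≤
      A * δ * Real.exp (-(θ * backlog y)) + net.K * overchargedIndicator y := fun y => by
    rw [← slotMean_const (net := net) α
      (A * δ * Real.exp (-(θ * backlog y)) + net.K * overchargedIndicator y)]
    refine slotMean_mono α fun w => ?_
    have h1 : 0 ≤ A * δ * Real.exp (-(θ * backlog y)) := by positivity
    have h2 := mul_nonneg hKr.le (overchargedIndicator_nonneg y)
    by_cases hq : y.qd = 0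
    · have hle : (1 : ℝ) ≤ Real.exp (θ * net.N) * Real.exp (-(θ * backlog y)) := by
        rw [← Real.exp_add, Real.one_le_exp_iff]
        have := mul_le_mul_of_nonneg_left (backlog_le_of_qd_eq_zero hq) hθ0.le
        linarith
      have hAδ : A * δ = net.K * Real.exp (θ * net.N) := div_mul_cancel₀ _ hδ0.ne'
      have := mul_le_mul_of_nonneg_left hle hKr.le
      have := overflow_le hb y w
      rw [hAδ]
      linarith
    · by_cases hy : Overcharged y
      · rw [show overchargedIndicator y = 1 from if_pos hy]
        linarith [overflow_le hb y w]
      · rw [overflow_eq_zero_of_not_overcharged hb hq hy]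
        exact add_nonneg h1 h2
  have hdrift : ∀ y, stepMean α U y ≤ U y + -1 * slotMean α (overflow y) := fun y => by
    have hexp := stepMean_exp_backlog_le hb α hθ0.le hθK y
    have hstep : stepMean α U y = A * stepMean α (fun y => Real.exp (-(θ * backlog y))) y := by
      simp only [stepMean, hU, overchargedIndicator_next hN, mul_zero, add_zero,
        slotMean_const_mul]
    have hfac : 1 - θ * μ + (θ * (2 * net.K)) ^ 2 = 1 - δ := by
      rw [hδ, ← hθμ]
      ring
    rw [← hμ, hfac] at hexp
    have := mul_le_mul_of_nonneg_left hexp hA0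
    have := hover y
    rw [hstep]
    simp only [hU]
    linarith
  refine ⟨U x, fun n => ?_⟩
  have h := meanAt_le_of_drift α hdrift n x
  simp only [meanAt_const_mul, ← Finset.mul_sum] at h
  have := meanAt_nonneg α n hU0 x
  linarith

lemma hasDepartureRate_of_drift_pos (hb : net.bmax ≤ net.K) (hN : 2 * net.K ≤ net.N)
    (hK : 0 < net.K) {α : unitInterval} (hα : 0 < drift net α) :
    net.HasDepartureRate α (net.pR * ((1 - α) * net.meanHarvest) / net.K) := by
  refine (hasRate_iff _ _ _).mpr fun x => ?_
  have hKr : (0 : ℝ) < net.K := by exact_mod_cast hK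
  obtain ⟨C, hC⟩ := exists_sum_overflow_le hb hN hK hα x
  set O : ℕ → ℝ := fun n => ∑ t ∈ Finset.range n,
    meanAt α t (fun y => slotMean α (overflow y)) x with hO
  set T : ℕ → ℝ := fun n => ∑ t ∈ Finset.range n,
    meanAt α t (fun y => slotMean α (transmissions y)) x with hT
  have hO0 : ∀ n, 0 ≤ O n := fun n => Finset.sum_nonneg fun t _ => meanAt_nonneg α t
    (fun y => (slotMean_const α 0).symm.trans_le (slotMean_mono α (overflow_nonneg y))) x
  have hstep : ∀ y : net.State, stepMean α (fun y => ((y.qe : ℕ) : ℝ)) y =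
      (y.qe : ℕ) + ((1 - α) * net.meanHarvest + (-1 * slotMean α (overflow y) +
        -net.K * slotMean α (transmissions y))) := fun y => by
    simp only [stepMean, next_qe]
    rw [slotMean_sub, slotMean_sub, slotMean_add, slotMean_const, slotMean_const_mul,
      slotMean_harvested]
    ring
  set Q : ℕ → ℝ := fun n => meanAt α n (fun y => ((y.qe : ℕ) : ℝ)) x with hQ
  have hQ0 : ∀ n, 0 ≤ Q n := fun n => meanAt_nonneg α n (fun y => Nat.cast_nonneg _) x
  have hQN : ∀ n, Q n ≤ net.N := fun n => by
    rw [← meanAt_const α n (net.N : ℝ) x]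
    exact meanAt_mono α n (fun y => by exact_mod_cast Nat.le_of_lt_succ y.qe.isLt) x
  have hbal : ∀ n : ℕ, Q n =
      (x.qe : ℕ) + n * ((1 - α) * net.meanHarvest) - O n - net.K * T n := fun n => by
    rw [hQ]
    simp only
    rw [meanAt_eq_of_drift α hstep]
    simp only [meanAt_add, meanAt_const_mul, meanAt_const, Finset.sum_add_distrib,
      Finset.sum_const, Finset.card_range, nsmul_eq_mul, ← Finset.mul_sum, hO, hT]
    ring
  have hrem : Tendsto (fun n : ℕ => (((x.qe : ℕ) : ℝ) - O n - Q n) / (n : ℝ)) atTop (𝓝 0) := by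
    have hx0 : (0 : ℝ) ≤ ((x.qe : ℕ) : ℝ) := Nat.cast_nonneg _
    refine squeeze_zero_norm (a := fun n : ℕ => ((x.qe : ℕ) + C + net.N : ℝ) / (n : ℝ))
      (fun n => ?_) (tendsto_const_nhds.div_atTop tendsto_natCast_atTop_atTop)
    rw [Real.norm_eq_abs, abs_div, abs_of_nonneg (Nat.cast_nonneg (α := ℝ) n)]
    refine div_le_div_of_nonneg_right (abs_le.mpr ?_) (Nat.cast_nonneg _)
    have h1 := hO0 n
    have h2 := hC n
    have h3 := hQ0 n
    have h4 := hQN n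
    constructor <;> linarith
  have hlim := (hrem.add_const ((1 - (α : ℝ)) * net.meanHarvest)).const_mul
    ((net.pR : ℝ) / net.K)
  rw [zero_add] at hlim
  rw [mul_div_right_comm]
  refine hlim.congr' ?_
  filter_upwards [eventually_ge_atTop 1] with n hn
  have hn0 : (n : ℝ) ≠ 0 := by exact_mod_cast Nat.one_le_iff_ne_zero.mp hn
  simp only [slotMean_departures, meanAt_const_mul, ← Finset.mul_sum]
  rw [hbal]
  change _ = net.pR * T n / n
  field_simp
  ring

/-! ### Throughput and stability -/

lemma hasArrivalRate (α : unitInterval) : net.HasArrivalRate α (α * (1 - net.pS)) := by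
  refine (hasRate_iff _ _ _).mpr fun x => tendsto_const_nhds.congr' ?_
  filter_upwards [eventually_ge_atTop 1] with n hn
  have hn0 : (n : ℝ) ≠ 0 := by exact_mod_cast Nat.one_le_iff_ne_zero.mp hn
  simp only [slotMean_arrivals, meanAt_const, Finset.sum_const, Finset.card_range, nsmul_eq_mul]
  rw [mul_div_cancel_left₀ _ hn0]

lemma hasThroughput_of_hasDepartureRate {α : unitInterval} {d : ℝ}
    (h : net.HasDepartureRate α d) : net.HasThroughput α (net.pS + d) := by
  refine (hasRate_iff _ _ _).mpr fun x =>
    (((hasRate_iff _ _ _).mp h x).const_add (net.pS : ℝ)).congr' ?_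
  filter_upwards [eventually_ge_atTop 1] with n hn
  have hn0 : (n : ℝ) ≠ 0 := by exact_mod_cast Nat.one_le_iff_ne_zero.mp hn
  simp only [slotMean_detections, meanAt_add, meanAt_const, Finset.sum_add_distrib,
    Finset.sum_const, Finset.card_range, nsmul_eq_mul]
  rw [add_div, mul_div_cancel_left₀ _ hn0]

lemma HasRate.unique {α : unitInterval} {f : net.State → net.Slot → ℕ} {r s : ℝ}
    (hr : HasRate α f r) (hs : HasRate α f s) : r = s :=
  tendsto_nhds_unique (hr ⟨0, 0⟩) (hs ⟨0, 0⟩)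

/-- The departure rate is the smaller one of the arrival rate and the rate at which the harvested
energy pays for detected transmissions. -/
lemma hasDepartureRate_min (hb : net.bmax ≤ net.K) (hN : 2 * net.K ≤ net.N) (hK : 0 < net.K)
    (α : unitInterval) : net.HasDepartureRate α
      (min (α * (1 - net.pS)) (net.pR * ((1 - α) * net.meanHarvest) / net.K)) := by
  have hKr : (0 : ℝ) < net.K := by exact_mod_cast hK
  rcases le_or_gt (drift net α) 0 with h | h
  · rw [min_eq_left]
    · exact hasDepartureRate_of_drift_nonpos hb hN hK h
    · rw [le_div_iff₀ hKr]
      unfold drift at h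
      linarith
  · rw [min_eq_right]
    · exact hasDepartureRate_of_drift_pos hb hN hK h
    · rw [div_le_iff₀ hKr]
      unfold drift at h
      linarith

lemma K_pos_of_meanHarvest_pos (hb : net.bmax ≤ net.K) (hΓ : 0 < net.meanHarvest) :
    0 < net.K := by
  rcases Nat.eq_zero_or_pos net.K with h | h
  · refine absurd hΓ (not_lt.mpr (Finset.sum_nonpos fun m _ => ?_))
    have hm : (m : ℕ) = 0 := by omega
    simp [hm]
  · exact h

end RelayNetwork

end

theorem proposition1 (net : RelayNetwork)
    (hb : net.bmax ≤ net.K) (hN : 2 * net.K ≤ net.N)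
    (hΓ : 0 < net.meanHarvest) (hS : (net.pS : ℝ) < 1) (hR : 0 < (net.pR : ℝ)) :
    (∀ α : unitInterval, ∃ r : ℝ, net.HasThroughput α r) ∧
    (∀ α : unitInterval, net.IsThroughputOptimal α → net.AtStabilityBoundary α) ∧
    (∀ α : unitInterval, net.IsThroughputOptimal α ↔
      (α : ℝ) = net.meanHarvest * (net.pR : ℝ) /
        (net.meanHarvest * (net.pR : ℝ) + (net.K : ℝ) * (1 - (net.pS : ℝ)))) ∧
    (∀ α : unitInterval, net.AtStabilityBoundary α → net.IsThroughputOptimal α) := by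
  have hK := RelayNetwork.K_pos_of_meanHarvest_pos hb hΓ
  have hKr : (0 : ℝ) < net.K := by exact_mod_cast hK
  set u : ℝ := 1 - (net.pS : ℝ) with hu
  have hu0 : 0 < u := sub_pos.mpr hS
  set e : ℝ := net.meanHarvest * (net.pR : ℝ) with he
  have he0 : 0 < e := mul_pos hΓ hR
  have hKu : 0 < (net.K : ℝ) * u := mul_pos hKr hu0
  -- The arrival rate `a * u` and the energy-limited rate `(1 - a) * e / K` cross at `αT`.
  have hmem : e / (e + net.K * u) ∈ unitInterval :=
    ⟨by positivity, (div_le_one (by positivity)).mpr (by linarith)⟩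
  set αT : unitInterval := ⟨e / (e + net.K * u), hmem⟩ with hαT
  have hcross : (αT : ℝ) * u = (1 - αT) * (e / net.K) := by
    change e / (e + net.K * u) * u = (1 - e / (e + net.K * u)) * (e / net.K)
    field_simp
    ring
  have heK : 0 < e / net.K := by positivity
  set d : unitInterval → ℝ := fun a => min (a * u) ((1 - a) * (e / net.K)) with hd
  have hdep : ∀ a, net.HasDepartureRate a (d a) := fun a => by
    have h := RelayNetwork.hasDepartureRate_min hb hN hK a
    rwa [show (net.pR : ℝ) * ((1 - a) * net.meanHarvest) / net.K = (1 - a) * (e / net.K) by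
      rw [he]; ring] at h
  have hthr := fun a => RelayNetwork.hasThroughput_of_hasDepartureRate (hdep a)
  have hdT : d αT = αT * u := min_eq_left hcross.le
  have hlt : ∀ a, a ≠ αT → d a < d αT := fun a ha => by
    rw [hdT]
    rcases lt_or_gt_of_ne (fun h => ha (Subtype.ext h) : (a : ℝ) ≠ αT) with h | h
    · exact (min_le_left _ _).trans_lt (mul_lt_mul_of_pos_right h hu0)
    · rw [hcross]
      exact (min_le_right _ _).trans_lt (mul_lt_mul_of_pos_right (by linarith) heK)
  have hopt : ∀ a, net.IsThroughputOptimal a ↔ a = αT := fun a => by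
    constructor
    · rintro ⟨r, hr, hmax⟩
      by_contra hne
      have h1 := hmax αT _ (hthr αT)
      have h2 := RelayNetwork.HasRate.unique hr (hthr a)
      have h3 := hlt a hne
      linarith
    · rintro rfl
      refine ⟨_, hthr _, fun b r' hr' => ?_⟩
      rw [RelayNetwork.HasRate.unique hr' (hthr b)]
      by_cases hb' : b = αT
      · rw [hb']
      · linarith [hlt b hb']
  have hbdry : ∀ a, net.AtStabilityBoundary a ↔ a = αT := fun a => by
    constructor
    · rintro ⟨⟨r, hra, hrd⟩, hunst⟩
      refine Subtype.ext (le_antisymm ?_ ?_)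
      · by_contra! h
        have h1 := RelayNetwork.HasRate.unique hra (RelayNetwork.hasArrivalRate a)
        have h2 := RelayNetwork.HasRate.unique hrd (hdep a)
        have h3 := hlt a (fun h' => h.ne' (congrArg _ h'))
        have h4 := mul_lt_mul_of_pos_right h hu0
        rw [hdT] at h3
        linarith
      · by_contra! h
        -- `αT` has a larger arrival rate, but is stable.
        obtain ⟨a', d', ha', hd', hlt'⟩ := hunst (a * u) (αT * u - a * u)
          (sub_pos.mpr (mul_lt_mul_of_pos_right h hu0)) αT (RelayNetwork.hasArrivalRate a)
          (by rw [add_sub_cancel]; exact RelayNetwork.hasArrivalRate αT)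
        have h1 := RelayNetwork.HasRate.unique ha' (RelayNetwork.hasArrivalRate αT)
        have h2 := RelayNetwork.HasRate.unique hd' (hdep αT)
        rw [hdT] at h2
        linarith
    · rintro rfl
      refine ⟨⟨_, RelayNetwork.hasArrivalRate _, hdT ▸ hdep _⟩, fun r ε hε b hr hbr => ?_⟩
      have h1 := RelayNetwork.HasRate.unique hr (RelayNetwork.hasArrivalRate _)
      have h2 := RelayNetwork.HasRate.unique hbr (RelayNetwork.hasArrivalRate b)
      have h3 : (αT : ℝ) * u < b * u := by linarith
      refine ⟨_, _, RelayNetwork.hasArrivalRate b, hdep b, ?_⟩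
      have hne : b ≠ αT := fun h => h3.ne' (by rw [h])
      have h4 := hlt b hne
      rw [hdT] at h4
      exact h4.trans h3
  refine ⟨fun a => ⟨_, hthr a⟩, fun a h => (hbdry a).mpr ((hopt a).mp h), fun a => ?_,
    fun a h => (hopt a).mpr ((hbdry a).mp h)⟩
  rw [hopt a]
  exact Subtype.ext_iff
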